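/- Let $d\in\{2,3\}$, let $\Omega\subset\mathbb R^d$ be a bounded domain, let $\omega$ be a non-empty open set with $\overline\omega\subset\Omega$, let $T>0$, and put $Q_T=\Omega\times(0,T)$, $q_T=\omega\times(0,T)$, $\Sigma_T=\partial\Omega\times(0,T)$, $\boldsymbol V=H^1_0(\Omega)\times L^2(\Omega)$. Let $g\in C^1(\mathbb R)$ satisfy $|g(r)|\le C(1+|r|)\ln(2+|r|)$ for all $r\in\mathbb R$ and some $C>0$, and assume that for some $s\in[0,1]$ $$(\overline{\bf H}_s)\qquad \sup_{a\ne b}\frac{|g'(a)-g'(b)|}{|a-b|^s}<+\infty$$ (for $s=0$ this means that $g'$ is bounded). Let $\mathcal H$ be the vector space of pairs $(y,f)\in L^2(Q_T)\times L^2(q_T)$ such that $\partial_{tt}y-\Delta y\in L^2(Q_T)$ in the sense of distributions, $(y(\cdot,0),\partial_ty(\cdot,0))\in\boldsymbol V$ and $y=0$ on $\Sigma_T$. Here $y=0$ on $\Sigma_T$ means that $y$ lies in the closure of $C_c^\infty(\Omega\times\mathbb R)$ in $H^1(Q_T)$. The relation $(y(\cdot,0),\partial_ty(\cdot,0))=(u_0,u_1)$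 is understood through Green's formula $$\int_{Q_T}y(\partial_{tt}\eta-\Delta\eta)=\int_{Q_T}(\partial_{tt}y-\Delta y)\,\eta+\int_\Omega u_1\,\eta(\cdot,0)-\int_\Omega u_0\,\partial_t\eta(\cdot,0)\qquad\forall\,\eta\in C_c^\infty(\Omega\times(-\infty,T)),$$ and $(y(\cdot,T),\partial_ty(\cdot,T))=(z_0,z_1)$ through the corresponding formula at $t=T$ with $\eta\in C_c^\infty(\Omega\times(0,\infty))$. For $(u_0,u_1),(z_0,z_1)\in\boldsymbol V$ let $$\mathcal A=\{(y,f)\in\mathcal H:\ (y(\cdot,0),\partial_ty(\cdot,0))=(u_0,u_1),\ (y(\cdot,T),\partial_ty(\cdot,T))=(z_0,z_1)\},$$ let $\mathcal A_0$ be the same set with $(u_0,u_1)=(z_0,z_1)=(0,0)$, and let $$E(y,f)=\tfrac12\big\|\partial_{tt}y-\Delta y+g(y)-f\,1_\omega\big\|^2_{L^2(Q_T)} .$$ Then for every $(y,f)\in\mathcal A$ the function $\partial_{tt}y-\Delta y+g(y)-f1_\omega$ belongs to $L^2(Q_T)$, and $E$ is differentiable at $(y,f)$ along every direction $(Y,F)\in\mathcal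 A_0$, that is, $\lambda\mapsto E(y+\lambda Y,f+\lambda F)$ is differentiable at $\lambda=0$. Moreover, if $(Y^1,F^1)\in\mathcal A_0$ satisfies $$\partial_{tt}Y^1-\Delta Y^1+g'(y)\,Y^1=F^1\,1_\omega+\big(\partial_{tt}y-\Delta y+g(y)-f\,1_\omega\big)\quad\text{in }Q_T,$$ then the derivative of $E$ at $(y,f)$ along $(Y^1,F^1)$ is $$E'(y,f)\cdot(Y^1,F^1)=2E(y,f).$$ -/

import Mathlib

open MeasureTheory Set Filter Topology

namespace WaveControl

noncomputable section

/-- Points of space, `ℝᵈ` with the Euclidean norm. -/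
abbrev Space (d : ℕ) : Type := EuclideanSpace ℝ (Fin d)

/-- Points `(x, t)` of space-time `ℝᵈ × ℝ`. -/
abbrev SpaceTime (d : ℕ) : Type := Space d × ℝ

/-- The cylinder `S × (0, T)`: it is `Q_T` for `S = Ω` and `q_T` for `S = ω`. -/
def cyl {d : ℕ} (S : Set (Space d)) (T : ℝ) : Set (SpaceTime d) := S ×ˢ Ioo 0 T

/-- `φ ∈ C_c^∞(U)`. -/
def IsTest {E : Type*} [NormedAddCommGroup E] [NormedSpace ℝ E] (U : Set E) (φ : E → ℝ) : Prop :=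
  ContDiff ℝ ((⊤ : ℕ∞) : WithTop ℕ∞) φ ∧ HasCompactSupport φ ∧ tsupport φ ⊆ U

/-- `∂ᵢ φ` for a function of `x` alone. -/
def pd {d : ℕ} (i : Fin d) (φ : Space d → ℝ) (x : Space d) : ℝ :=
  fderiv ℝ φ x (EuclideanSpace.single i 1)

/-- `∂ₜ φ` for a function of `(x, t)`. -/
def dt {d : ℕ} (φ : SpaceTime d → ℝ) (p : SpaceTime d) : ℝ :=
  fderiv ℝ φ p (0, 1)

/-- `∂φ / ∂xᵢ` for a function of `(x, t)`. -/
def dx {d : ℕ} (i : Fin d) (φ : SpaceTime d → ℝ) (p : SpaceTime d) : ℝ :=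
  fderiv ℝ φ p (EuclideanSpace.single i 1, 0)

/-- The classical wave operator `∂ₜₜ φ - Δ φ`, applied to test functions. -/
def boxTest {d : ℕ} (φ : SpaceTime d → ℝ) (p : SpaceTime d) : ℝ :=
  dt (dt φ) p - ∑ i, dx i (dx i φ) p

/-- `u ∈ H¹₀(Ω)`: `u` is a limit in the `H¹(Ω)` norm of functions in `C_c^∞(Ω)`
(`q` is then the weak gradient of `u`). -/
def MemH10 {d : ℕ} (Ω : Set (Space d)) (u : Space d → ℝ) : Prop :=
  MemLp u 2 (volume.restrict Ω) ∧
  ∃ q : Fin d → Space d → ℝ, (∀ i, MemLp (q i) 2 (volume.restrict Ω)) ∧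
  ∃ φ : ℕ → Space d → ℝ, (∀ n, IsTest Ω (φ n)) ∧
    Tendsto (fun n => eLpNorm (φ n - u) 2 (volume.restrict Ω)) atTop (𝓝 0) ∧
    ∀ i, Tendsto (fun n => eLpNorm (pd i (φ n) - q i) 2 (volume.restrict Ω)) atTop (𝓝 0)

/-- `(u₀, u₁) ∈ V = H¹₀(Ω) × L²(Ω)`. -/
def MemV {d : ℕ} (Ω : Set (Space d)) (u₀ u₁ : Space d → ℝ) : Prop :=
  MemH10 Ω u₀ ∧ MemLp u₁ 2 (volume.restrict Ω)

/-- `y ∈ H¹(Q_T)` and `y = 0` on `Σ_T = ∂Ω × (0, T)`: `y` is a limit in the `H¹(Q_T)` norm of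
smooth functions on `Ω × ℝ` with compact support in `Ω × ℝ` (they vanish near `∂Ω`, with no
condition at `t = 0` or `t = T`). Here `v` and `q` are the weak derivatives `∂ₜ y` and `∇ y`. -/
def VanishesOnLateral {d : ℕ} (Ω : Set (Space d)) (T : ℝ) (y : SpaceTime d → ℝ) : Prop :=
  ∃ (v : SpaceTime d → ℝ) (q : Fin d → SpaceTime d → ℝ),
    MemLp v 2 (volume.restrict (cyl Ω T)) ∧
    (∀ i, MemLp (q i) 2 (volume.restrict (cyl Ω T))) ∧
  ∃ φ : ℕ → SpaceTime d → ℝ, (∀ n, IsTest (Ω ×ˢ univ) (φ n)) ∧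
    Tendsto (fun n => eLpNorm (φ n - y) 2 (volume.restrict (cyl Ω T))) atTop (𝓝 0) ∧
    Tendsto (fun n => eLpNorm (dt (φ n) - v) 2 (volume.restrict (cyl Ω T))) atTop (𝓝 0) ∧
    ∀ i, Tendsto (fun n => eLpNorm (dx i (φ n) - q i) 2 (volume.restrict (cyl Ω T)))
      atTop (𝓝 0)

/-- `w ∈ L²(Q_T)` and `∂ₜₜ y - Δ y = w` in the sense of distributions in `Q_T`. -/
def IsWaveOp {d : ℕ} (Ω : Set (Space d)) (T : ℝ) (y w : SpaceTime d → ℝ) : Prop :=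
  MemLp w 2 (volume.restrict (cyl Ω T)) ∧
  ∀ η : SpaceTime d → ℝ, IsTest (cyl Ω T) η →
    ∫ p in cyl Ω T, y p * boxTest η p = ∫ p in cyl Ω T, w p * η p

open Classical in
/-- The function `∂ₜₜ y - Δ y ∈ L²(Q_T)`, determined up to a null set in `Q_T`
(and the junk value `0` if the distribution `∂ₜₜ y - Δ y` is not in `L²(Q_T)`). -/
def waveOp {d : ℕ} (Ω : Set (Space d)) (T : ℝ) (y : SpaceTime d → ℝ) : SpaceTime d → ℝ :=
  if h : ∃ w, IsWaveOp Ω T y w then h.choose else 0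

/-- `(y(·,0), ∂ₜ y(·,0)) = (u₀, u₁)` in `Ω`, through Green's formula with test functions that
vanish near `∂Ω` and near `t = T`. -/
def HasInitialData {d : ℕ} (Ω : Set (Space d)) (T : ℝ) (y : SpaceTime d → ℝ)
    (u₀ u₁ : Space d → ℝ) : Prop :=
  ∀ η : SpaceTime d → ℝ, IsTest (Ω ×ˢ Iio T) η →
    ∫ p in cyl Ω T, y p * boxTest η p =
      (∫ p in cyl Ω T, waveOp Ω T y p * η p)
        + ((∫ x in Ω, u₁ x * η (x, 0)) - ∫ x in Ω, u₀ x * dt η (x, 0))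

/-- `(y(·,T), ∂ₜ y(·,T)) = (z₀, z₁)` in `Ω`, through Green's formula with test functions that
vanish near `∂Ω` and near `t = 0`. -/
def HasFinalData {d : ℕ} (Ω : Set (Space d)) (T : ℝ) (y : SpaceTime d → ℝ)
    (z₀ z₁ : Space d → ℝ) : Prop :=
  ∀ η : SpaceTime d → ℝ, IsTest (Ω ×ˢ Ioi 0) η →
    ∫ p in cyl Ω T, y p * boxTest η p =
      (∫ p in cyl Ω T, waveOp Ω T y p * η p)
        - ((∫ x in Ω, z₁ x * η (x, T)) - ∫ x in Ω, z₀ x * dt η (x, T))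

/-- The space `ℋ` of pairs `(y, f) ∈ L²(Q_T) × L²(q_T)` with `∂ₜₜ y - Δ y ∈ L²(Q_T)`,
`(y(·,0), ∂ₜ y(·,0)) ∈ V` and `y = 0` on `Σ_T`. -/
def spaceH {d : ℕ} (Ω ω : Set (Space d)) (T : ℝ) :
    Set ((SpaceTime d → ℝ) × (SpaceTime d → ℝ)) :=
  {P | MemLp P.1 2 (volume.restrict (cyl Ω T)) ∧
    MemLp P.2 2 (volume.restrict (cyl ω T)) ∧
    (∃ w, IsWaveOp Ω T P.1 w) ∧
    (∃ u₀ u₁, MemV Ω u₀ u₁ ∧ HasInitialData Ω T P.1 u₀ u₁) ∧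
    VanishesOnLateral Ω T P.1}

/-- The set `𝒜` of pairs in `ℋ` with initial data `(u₀, u₁)` and final data `(z₀, z₁)`. -/
def admissible {d : ℕ} (Ω ω : Set (Space d)) (T : ℝ) (u₀ u₁ z₀ z₁ : Space d → ℝ) :
    Set ((SpaceTime d → ℝ) × (SpaceTime d → ℝ)) :=
  {P | P ∈ spaceH Ω ω T ∧ HasInitialData Ω T P.1 u₀ u₁ ∧ HasFinalData Ω T P.1 z₀ z₁}

/-- The space `𝒜₀` of pairs in `ℋ` with zero initial and final data. -/
def admissibleZero {d : ℕ} (Ω ω : Set (Space d)) (T : ℝ) :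
    Set ((SpaceTime d → ℝ) × (SpaceTime d → ℝ)) :=
  admissible Ω ω T 0 0 0 0

/-- `f 1_ω`. -/
def localize {d : ℕ} (ω : Set (Space d)) (f : SpaceTime d → ℝ) : SpaceTime d → ℝ :=
  (ω ×ˢ (univ : Set ℝ)).indicator f

/-- The residual `∂ₜₜ y - Δ y + g(y) - f 1_ω`. -/
def residual {d : ℕ} (Ω ω : Set (Space d)) (T : ℝ) (g : ℝ → ℝ)
    (P : (SpaceTime d → ℝ) × (SpaceTime d → ℝ)) (p : SpaceTime d) : ℝ :=
  waveOp Ω T P.1 p + g (P.1 p) - localize ω P.2 p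

/-- The least-squares functional `E(y, f) = ½ ‖∂ₜₜ y - Δ y + g(y) - f 1_ω‖²` with the norm of
`L²(Q_T)`. -/
def energy {d : ℕ} (Ω ω : Set (Space d)) (T : ℝ) (g : ℝ → ℝ)
    (P : (SpaceTime d → ℝ) × (SpaceTime d → ℝ)) : ℝ :=
  (1 / 2) * ∫ p in cyl Ω T, residual Ω ω T g P p ^ 2

/-- The equation `∂ₜₜ Y - Δ Y + g'(y) Y = F 1_ω + (∂ₜₜ y - Δ y + g(y) - f 1_ω)` in `Q_T`, for
`P = (y, f)` and `D = (Y, F)`. -/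
def SolvesLinearized {d : ℕ} (Ω ω : Set (Space d)) (T : ℝ) (g : ℝ → ℝ)
    (P D : (SpaceTime d → ℝ) × (SpaceTime d → ℝ)) : Prop :=
  ∀ᵐ p ∂(volume.restrict (cyl Ω T)),
    waveOp Ω T D.1 p + deriv g (P.1 p) * D.1 p = localize ω D.2 p + residual Ω ω T g P p

/-- The Hölder seminorm `sup_{a ≠ b} |g'(a) - g'(b)| / |a - b|^s` is finite.
For `s = 0` this says that `g'` is bounded. -/
def HolderDeriv (g : ℝ → ℝ) (s : ℝ) : Prop :=
  BddAbove {r : ℝ | ∃ a b : ℝ, a ≠ b ∧ r = |deriv g a - deriv g b| / |a - b| ^ s}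

end

end WaveControl

/-! Along `(Y, F)` the weak wave operator is linear, so the residual at parameter `t` is `R + t L +
g(y + t Y) - g(y)`, with `R` the residual at `(y, f)` and `L = ∂ₜₜ Y - Δ Y - F 1_ω`. Differentiating
half its square under the integral gives `∫ R (L + g'(y) Y)`. The linearized equation says `L +
g'(y) Y = R`, and the derivative becomes `∫ R² = 2E`.

What needs proof is the domination. The hypotheses give `|g(r)| ≲ (1 + |r|)²` and `|g'(r)| ≲ 1 +
|r|`, so it suffices that `y` and `Y` lie in `L⁴(Q_T)`; then `g(y)` and `g'(y) Y` are in `L²`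
(`hasDerivAt_half_integral_sq`).

The `L⁴` bound (`VanishesOnLateral.memLp_four`) is the Sobolev embedding of `H¹` in dimension `d + 1
≤ 4`. No regularity of `∂Ω` is available, but the approximants vanish near `∂Ω`, and only the ends
`t = 0, T` need care. There a function is extended by even reflection in time and cut off, so that
the inequality for functions of bounded support applies (`exists_eLpNorm_four_le`). The reflection
is smoothed to keep the extension `C¹`, and the smoothing is removed in the limit. -/

namespace WaveControl

/-! ### Folding the line onto `[0, T]` -/

/-- A smooth regularization of `|t|`, for `ε ≠ 0`. -/
noncomputable def smoothAbs (ε t : ℝ) : ℝ := Real.sqrt (t ^ 2 + ε ^ 2)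

/-- For `ε = 0` this is the map folding `[-T, 2T]` onto `[0, T]`. -/
noncomputable def fold (T ε t : ℝ) : ℝ := T - smoothAbs ε (smoothAbs ε t - T)

lemma contDiff_smoothAbs {ε : ℝ} (hε : ε ≠ 0) {n : WithTop ℕ∞} : ContDiff ℝ n (smoothAbs ε) := by
  unfold smoothAbs
  refine ContDiff.sqrt (by fun_prop) fun t => ?_
  positivity

/-- `smoothAbs ε t` is the Euclidean length of `(t, ε)`, so this is the triangle inequality. The
constant does not depend on `ε`, which keeps the derivative bounds uniform as the smoothing is
removed. -/
lemma lipschitzWith_smoothAbs (ε : ℝ) : LipschitzWith 1 (smoothAbs ε) := by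
  refine LipschitzWith.of_le_add fun a b => ?_
  rw [Real.dist_eq]
  have h0 : 0 ≤ smoothAbs ε b := Real.sqrt_nonneg _
  have hsq : smoothAbs ε b ^ 2 = b ^ 2 + ε ^ 2 := Real.sq_sqrt (by positivity)
  have hb : |b| ≤ smoothAbs ε b := Real.abs_le_sqrt (by nlinarith [sq_nonneg ε])
  refine Real.sqrt_le_iff.2 ⟨by positivity, ?_⟩
  have h1 : b * (a - b) ≤ smoothAbs ε b * |a - b| :=
    (le_abs_self _).trans (by rw [abs_mul]; gcongr)
  nlinarith [sq_abs (a - b)]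

lemma smoothAbs_zero (t : ℝ) : smoothAbs 0 t = |t| := by simp [smoothAbs, Real.sqrt_sq_eq_abs]

lemma contDiff_fold (T : ℝ) {ε : ℝ} (hε : ε ≠ 0) {n : WithTop ℕ∞} : ContDiff ℝ n (fold T ε) :=
  contDiff_const.sub
    ((contDiff_smoothAbs hε).comp ((contDiff_smoothAbs hε).sub contDiff_const))

lemma lipschitzWith_fold (T ε : ℝ) : LipschitzWith 1 (fold T ε) := by
  refine LipschitzWith.of_dist_le_mul fun a b => ?_
  have h1 := (lipschitzWith_smoothAbs ε).dist_le_mul (smoothAbs ε a - T) (smoothAbs ε b - T)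
  have h2 := (lipschitzWith_smoothAbs ε).dist_le_mul a b
  simp only [fold, Real.dist_eq, NNReal.coe_one, one_mul] at *
  rw [abs_sub_comm, show T - smoothAbs ε (smoothAbs ε b - T) - (T - smoothAbs ε (smoothAbs ε a - T))
    = smoothAbs ε (smoothAbs ε a - T) - smoothAbs ε (smoothAbs ε b - T) by ring]
  refine h1.trans ?_
  rwa [sub_sub_sub_cancel_right]

lemma continuous_fold_param (T t : ℝ) : Continuous fun ε => fold T ε t := by
  unfold fold smoothAbs; fun_prop

lemma fold_zero (T t : ℝ) : fold T 0 t = T - |(|t| - T)| := by simp [fold, smoothAbs_zero]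

lemma fold_zero_of_mem {T t : ℝ} (h : t ∈ Icc 0 T) : fold T 0 t = t := by
  rw [fold_zero, abs_of_nonneg h.1, abs_of_nonpos (by linarith [h.2])]; ring

/-- On each of `[-T, 0]`, `[0, T]`, `[T, 2T]` the fold is an isometry onto `[0, T]`: `t ↦ -t`, the
identity, `t ↦ 2T - t`. Hence the factor 3. -/
lemma lintegral_fold_le {T : ℝ} (F : ℝ → ENNReal) :
    ∫⁻ t in Icc (-T) (2 * T), F (fold T 0 t) ≤ 3 * ∫⁻ t in Ioo 0 T, F t := by
  have hsub : Icc (-T) (2 * T) ⊆ (Icc (-T) 0 ∪ Icc 0 T) ∪ Icc T (2 * T) := by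
    intro t ht
    rcases le_total t 0 with h | h
    · exact Or.inl (Or.inl ⟨ht.1, h⟩)
    · rcases le_total t T with h' | h'
      · exact Or.inl (Or.inr ⟨h, h'⟩)
      · exact Or.inr ⟨h', ht.2⟩
  have e1 : ∫⁻ t in Icc (-T) 0, F (fold T 0 t) = ∫⁻ t in Icc 0 T, F t := by
    rw [← (Measure.measurePreserving_neg (volume : Measure ℝ)).setLIntegral_comp_preimage_emb
      (MeasurableEquiv.neg ℝ).measurableEmbedding F (Icc 0 T)]
    have : (Neg.neg ⁻¹' Icc 0 T : Set ℝ) = Icc (-T) 0 := by simp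
    rw [this]
    refine setLIntegral_congr_fun measurableSet_Icc fun t ht => ?_
    simp only [fold_zero]
    rw [abs_of_nonpos ht.2, abs_of_nonpos (by linarith [ht.1])]
    congr 1; ring
  have e2 : ∫⁻ t in Icc 0 T, F (fold T 0 t) = ∫⁻ t in Icc 0 T, F t :=
    setLIntegral_congr_fun measurableSet_Icc fun t ht => by simp only [fold_zero_of_mem ht]
  have e3 : ∫⁻ t in Icc T (2 * T), F (fold T 0 t) = ∫⁻ t in Icc 0 T, F t := by
    rw [← (Measure.measurePreserving_sub_left (volume : Measure ℝ) (2 * T)).setLIntegral_comp_preimage_emb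
      (MeasurableEquiv.subLeft (2 * T)).measurableEmbedding F (Icc 0 T)]
    have : ((fun t : ℝ => 2 * T - t) ⁻¹' Icc 0 T : Set ℝ) = Icc T (2 * T) := by
      ext t; simp only [mem_preimage, mem_Icc]; constructor <;> rintro ⟨h, h'⟩ <;>
        constructor <;> linarith
    rw [this]
    refine setLIntegral_congr_fun measurableSet_Icc fun t ht => ?_
    simp only [fold_zero]
    rw [abs_of_nonneg (a := t) (by linarith [ht.1, ht.2]), abs_of_nonneg (by linarith [ht.1])]
    congr 1; ring
  have e4 : ∫⁻ t in Icc 0 T, F t = ∫⁻ t in Ioo 0 T, F t :=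
    setLIntegral_congr Ioo_ae_eq_Icc.symm
  calc ∫⁻ t in Icc (-T) (2 * T), F (fold T 0 t)
      ≤ ∫⁻ t in (Icc (-T) 0 ∪ Icc 0 T) ∪ Icc T (2 * T), F (fold T 0 t) := lintegral_mono_set hsub
    _ ≤ ((∫⁻ t in Icc (-T) 0, F (fold T 0 t)) + ∫⁻ t in Icc 0 T, F (fold T 0 t))
        + ∫⁻ t in Icc T (2 * T), F (fold T 0 t) :=
        (lintegral_union_le _ _ _).trans (by gcongr; exact lintegral_union_le _ _ _)
    _ = 3 * ∫⁻ t in Ioo 0 T, F t := by rw [e1, e2, e3, e4]; ring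

/-! ### The Sobolev inequality in the cylinder -/

section Sobolev

variable {d : ℕ}

instance isAddHaarMeasure_spaceTime : (volume : Measure (SpaceTime d)).IsAddHaarMeasure :=
  inferInstanceAs ((volume : Measure (Space d)).prod (volume : Measure ℝ)).IsAddHaarMeasure

lemma finrank_spaceTime : Module.finrank ℝ (SpaceTime d) = d + 1 := by simp

lemma lintegral_fold_prod_le {T : ℝ} {Ω : Set (Space d)} {F : SpaceTime d → ENNReal}
    (hF : Measurable F) :
    ∫⁻ p in Ω ×ˢ Icc (-T) (2 * T), F (p.1, fold T 0 p.2) ≤ 3 * ∫⁻ p in cyl Ω T, F p := by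
  have hm : Measurable fun p : SpaceTime d => F (p.1, fold T 0 p.2) :=
    hF.comp (measurable_fst.prodMk
      ((lipschitzWith_fold T 0).continuous.measurable.comp measurable_snd))
  rw [cyl, Measure.volume_eq_prod, ← Measure.prod_restrict, ← Measure.prod_restrict,
    lintegral_prod _ hm.aemeasurable, lintegral_prod _ hF.aemeasurable,
    ← lintegral_const_mul _ hF.lintegral_prod_right']
  exact lintegral_mono fun x => lintegral_fold_le fun t => F (x, t)

/-- The size of a function and of its derivative at a point. -/
noncomputable def jetNorm (φ : SpaceTime d → ℝ) (p : SpaceTime d) : ℝ := ‖φ p‖ + ‖fderiv ℝ φ p‖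

lemma jetNorm_nonneg (φ : SpaceTime d → ℝ) (p : SpaceTime d) : 0 ≤ jetNorm φ p := by
  unfold jetNorm; positivity

lemma IsTest.continuous_jetNorm {U : Set (SpaceTime d)} {φ : SpaceTime d → ℝ} (hφ : IsTest U φ) :
    Continuous (jetNorm φ) :=
  hφ.1.continuous.norm.add (hφ.1.continuous_fderiv (by simp)).norm

lemma IsTest.exists_jetNorm_le {U : Set (SpaceTime d)} {φ : SpaceTime d → ℝ} (hφ : IsTest U φ) :
    ∃ B, ∀ p, jetNorm φ p ≤ B := by
  obtain ⟨a, ha⟩ := hφ.2.1.exists_bound_of_continuous hφ.1.continuous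
  obtain ⟨b, hb⟩ := (hφ.2.1.fderiv ℝ).exists_bound_of_continuous
    (hφ.1.continuous_fderiv (by simp))
  exact ⟨a + b, fun p => add_le_add (ha p) (hb p)⟩

/-- Derivative bound for `χ(t) φ(x, h(t))`. -/
lemma norm_fderiv_cutoff_comp_le {χ h : ℝ → ℝ} {φ : SpaceTime d → ℝ} {M : ℝ}
    (hχ : ContDiff ℝ 1 χ) (hh : ContDiff ℝ 1 h) (hh1 : LipschitzWith 1 h)
    (hφ : ContDiff ℝ 1 φ) (p : SpaceTime d) (hM : ‖χ p.2‖ ≤ M) (hM' : ‖fderiv ℝ χ p.2‖ ≤ M) :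
    ‖fderiv ℝ (fun p : SpaceTime d => χ p.2 * φ (p.1, h p.2)) p‖ ≤ M * jetNorm φ (p.1, h p.2) := by
  have hM0 : 0 ≤ M := (norm_nonneg _).trans hM
  have d1 : DifferentiableAt ℝ (fun p : SpaceTime d => χ p.2) p :=
    ((hχ.differentiable (by simp)).comp differentiable_snd) p
  have hΦ : ContDiff ℝ 1 (fun p : SpaceTime d => (p.1, h p.2)) :=
    contDiff_fst.prodMk (hh.comp contDiff_snd)
  -- Space-time carries the sup norm of the product, so the constant is the maximum of the two
  -- factors' constants.
  have hΦL : LipschitzWith 1 (fun p : SpaceTime d => (p.1, h p.2)) := by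
    simpa using LipschitzWith.prod_fst.prodMk (hh1.comp LipschitzWith.prod_snd)
  have d2 : DifferentiableAt ℝ (fun p : SpaceTime d => φ (p.1, h p.2)) p :=
    ((hφ.differentiable (by simp)).comp (hΦ.differentiable (by simp))) p
  have n1 : ‖fderiv ℝ (fun p : SpaceTime d => χ p.2) p‖ ≤ M := by
    have : fderiv ℝ (fun p : SpaceTime d => χ p.2) p
        = (fderiv ℝ χ p.2).comp (ContinuousLinearMap.snd ℝ (Space d) ℝ) := by
      rw [← fderiv_snd (𝕜 := ℝ) (p := p)]
      exact fderiv_comp p (hχ.differentiable (by simp) _) differentiableAt_snd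
    rw [this]
    exact (ContinuousLinearMap.opNorm_comp_le _ _).trans
      ((mul_le_mul hM' (ContinuousLinearMap.norm_snd_le ..) (norm_nonneg _) hM0).trans_eq
        (mul_one M))
  have n2 : ‖fderiv ℝ (fun p : SpaceTime d => φ (p.1, h p.2)) p‖
      ≤ ‖fderiv ℝ φ (p.1, h p.2)‖ := by
    have : fderiv ℝ (fun p : SpaceTime d => φ (p.1, h p.2)) p
        = (fderiv ℝ φ (p.1, h p.2)).comp (fderiv ℝ (fun p : SpaceTime d => (p.1, h p.2)) p) :=
      fderiv_comp p (hφ.differentiable (by simp) _) (hΦ.differentiable (by simp) _)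
    rw [this]
    refine (ContinuousLinearMap.opNorm_comp_le _ _).trans ?_
    have := norm_fderiv_le_of_lipschitz ℝ (x₀ := p) hΦL
    exact mul_le_of_le_one_right (norm_nonneg _) (by simpa using this)
  rw [fderiv_fun_mul d1 d2]
  refine (norm_add_le _ _).trans ?_
  rw [norm_smul, norm_smul, jetNorm, mul_add, add_comm]
  refine add_le_add ?_ ?_
  · rw [mul_comm]; gcongr
  · gcongr

lemma IsTest.eq_zero_of_notMem {E : Type*} [NormedAddCommGroup E] [NormedSpace ℝ E] {U : Set E}
    {φ : E → ℝ} (hφ : IsTest U φ) {p : E} (hp : p ∉ U) :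
    φ p = 0 ∧ fderiv ℝ φ p = 0 :=
  ⟨image_eq_zero_of_notMem_tsupport fun h => hp (hφ.2.2 h),
    image_eq_zero_of_notMem_tsupport fun h => hp (hφ.2.2 (tsupport_fderiv_subset ℝ h))⟩

/-- The Sobolev inequality `H¹(Q_T) ⊂ L⁴(Q_T)` for functions vanishing near `∂Ω`. -/
theorem exists_eLpNorm_four_le (hd : d = 2 ∨ d = 3) {Ω : Set (Space d)} (hΩ : MeasurableSet Ω)
    (hΩb : Bornology.IsBounded Ω) {T : ℝ} (hT : 0 < T) :
    ∃ C : ENNReal, C ≠ ⊤ ∧ ∀ φ : SpaceTime d → ℝ, IsTest (Ω ×ˢ univ) φ →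
      eLpNorm φ 4 (volume.restrict (cyl Ω T))
        ≤ C * eLpNorm (jetNorm φ) 2 (volume.restrict (cyl Ω T)) := by
  -- With centre `T / 2`, these radii make `χ` equal to 1 on `[0, T]` and supported in `[-T, 2T]`,
  -- the interval that the fold maps onto `[0, T]`.
  let χ : ContDiffBump (T / 2) := ⟨T / 2, 3 * T / 2, by linarith, by linarith⟩
  have hχc : ContDiff ℝ 1 χ := χ.contDiff
  obtain ⟨m, hm⟩ := (χ.hasCompactSupport.fderiv ℝ).exists_bound_of_continuous
    (hχc.continuous_fderiv (by simp))
  set M : ℝ := max 1 m with hMdef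
  have hM0 : 0 ≤ M := le_max_of_le_left zero_le_one
  have hχM : ∀ t, ‖χ t‖ ≤ M := fun t => by
    rw [Real.norm_of_nonneg χ.nonneg]; exact χ.le_one.trans (le_max_left _ _)
  have hχM' : ∀ t, ‖fderiv ℝ χ t‖ ≤ M := fun t => (hm t).trans (le_max_right _ _)
  have hχsupp : tsupport χ = Icc (-T) (2 * T) := by
    rw [χ.tsupport_eq, Real.closedBall_eq_Icc]; congr 1 <;> simp [χ] <;> ring
  have hχ1 : ∀ t ∈ Ioo 0 T, χ t = 1 := fun t ht => by
    refine χ.one_of_mem_closedBall ?_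
    rw [Real.closedBall_eq_Icc]; constructor <;> simp [χ] <;> linarith [ht.1, ht.2]
  set S : Set (SpaceTime d) := Ω ×ˢ Icc (-T) (2 * T) with hS
  have hSm : MeasurableSet S := hΩ.prod measurableSet_Icc
  have hSb : Bornology.IsBounded S := hΩb.prod (Metric.isBounded_Icc _ _)
  let K := eLpNormLESNormFDerivOfLeConst ℝ (volume : Measure (SpaceTime d)) S 2 4
  refine ⟨K * (ENNReal.ofReal M * (3 : ENNReal) ^ (1 / 2 : ℝ)), by finiteness, fun φ hφ => ?_⟩
  obtain ⟨B, hB⟩ := hφ.exists_jetNorm_le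
  have hφ1 : ContDiff ℝ 1 φ := hφ.1.of_le (by exact_mod_cast le_top)
  let ε : ℕ → ℝ := fun n => 1 / ((n : ℝ) + 1)
  have hε0 : ∀ n, ε n ≠ 0 := fun n => by positivity
  have hεt : Tendsto ε atTop (𝓝 0) := tendsto_one_div_add_atTop_nhds_zero_nat
  let Ψ : ℝ → SpaceTime d → ℝ := fun e p => χ p.2 * φ (p.1, fold T e p.2)
  let G : ℝ → SpaceTime d → ℝ := fun e p => jetNorm φ (p.1, fold T e p.2)
  have hΦ : ∀ e, Continuous fun p : SpaceTime d => (p.1, fold T e p.2) := fun e =>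
    continuous_fst.prodMk ((lipschitzWith_fold T e).continuous.comp continuous_snd)
  have hGc : ∀ e, Continuous (G e) := fun e => hφ.continuous_jetNorm.comp (hΦ e)
  have hΨc : ∀ e, Continuous (Ψ e) := fun e =>
    (χ.continuous.comp continuous_snd).mul (hφ.1.continuous.comp (hΦ e))
  have hzero : ∀ t, t ∉ Icc (-T) (2 * T) → χ t = 0 ∧ fderiv ℝ χ t = 0 := fun t ht => by
    rw [← hχsupp] at ht
    exact ⟨image_eq_zero_of_notMem_tsupport ht,
      image_eq_zero_of_notMem_tsupport fun h => ht (tsupport_fderiv_subset ℝ h)⟩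
  have hΨsupp : ∀ e, Function.support (Ψ e) ⊆ S := by
    intro e p hp
    by_contra hpS
    refine hp ?_
    by_cases h1 : p.1 ∈ Ω
    · have h2 : p.2 ∉ Icc (-T) (2 * T) := fun h2 => hpS ⟨h1, h2⟩
      simp [Ψ, (hzero _ h2).1]
    · simp [Ψ, (hφ.eq_zero_of_notMem (p := (p.1, fold T e p.2)) (fun h => h1 h.1)).1]
  have hΨd : ∀ n p, ‖fderiv ℝ (Ψ (ε n)) p‖ ≤ ‖S.indicator (fun p => M * G (ε n) p) p‖ := by
    intro n p
    -- The bound is needed with two constants: `M` in general, and 0 at times outside the support of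
    -- `χ`.
    have key := fun M' => norm_fderiv_cutoff_comp_le (M := M') hχc (contDiff_fold T (hε0 n))
      (lipschitzWith_fold T (ε n)) hφ1 p
    by_cases hp : p ∈ S
    · rw [indicator_of_mem hp]
      exact (key M (hχM _) (hχM' _)).trans (Real.le_norm_self _)
    · rw [indicator_of_notMem hp, norm_zero]
      by_cases h1 : p.1 ∈ Ω
      · have h2 : p.2 ∉ Icc (-T) (2 * T) := fun h2 => hp ⟨h1, h2⟩
        have := key 0 (by simp [(hzero _ h2).1]) (by simp [(hzero _ h2).2])
        rwa [zero_mul] at this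
      · have h3 := hφ.eq_zero_of_notMem (p := (p.1, fold T (ε n) p.2)) (fun h => h1 h.1)
        have := key M (hχM _) (hχM' _)
        rwa [jetNorm, h3.1, h3.2, norm_zero, norm_zero, add_zero, mul_zero] at this
  have hsob : ∀ n, eLpNorm (Ψ (ε n)) 4 volume
      ≤ K * (ENNReal.ofReal M * eLpNorm (G (ε n)) 2 (volume.restrict S)) := by
    intro n
    have hc : ContDiff ℝ 1 (Ψ (ε n)) :=
      (hχc.comp contDiff_snd).mul
        (hφ1.comp (contDiff_fst.prodMk ((contDiff_fold T (hε0 n)).comp contDiff_snd)))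
    -- The exponent condition is `1/2 - 1/(d+1) ≤ 1/4`, strict for `d = 2` and an equality, the
    -- critical exponent, for `d = 3`.
    have h := eLpNorm_le_eLpNorm_fderiv_of_le (volume : Measure (SpaceTime d)) hc
      (hΨsupp (ε n)) (p := 2) (q := 4) (by norm_num)
      (by rw [finrank_spaceTime]; rcases hd with rfl | rfl <;> norm_num)
      (by rw [finrank_spaceTime]; rcases hd with rfl | rfl <;> norm_num) hSb
    refine h.trans (mul_le_mul_right ?_ _)
    refine (eLpNorm_mono (hΨd n)).trans ?_
    change eLpNorm _ (2 : ENNReal) _ ≤ _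
    rw [eLpNorm_indicator_eq_eLpNorm_restrict hSm]
    have := eLpNorm_const_smul_le (c := M) (f := G (ε n)) (p := 2) (μ := volume.restrict S)
    rwa [Real.enorm_of_nonneg hM0] at this
  have hpow : ∀ f : SpaceTime d → ℝ, ∀ μ : Measure (SpaceTime d),
      eLpNorm f 2 μ = (∫⁻ p, ‖f p‖ₑ ^ (2 : ℝ) ∂μ) ^ (1 / 2 : ℝ) := fun f μ => by
    rw [eLpNorm_eq_lintegral_rpow_enorm_toReal (by simp) (by simp)]; simp
  have hSfin : volume S ≠ ⊤ := hSb.measure_lt_top.ne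
  -- For `ε ≠ 0` the smoothed fold may leave `[0, T]`, which is harmless because `φ` is defined for
  -- all times. Only the limit has to be controlled by `Q_T`; dominated convergence applies since
  -- the jet of `φ` is bounded and `S` has finite measure.
  have hlim : Tendsto (fun n => eLpNorm (G (ε n)) 2 (volume.restrict S)) atTop
      (𝓝 (eLpNorm (G 0) 2 (volume.restrict S))) := by
    simp only [hpow]
    refine (ENNReal.continuous_rpow_const.tendsto _).comp ?_
    refine tendsto_lintegral_of_dominated_convergence (fun _ => ENNReal.ofReal B ^ (2 : ℝ))
      (fun n => ((hGc _).enorm.measurable.pow_const _)) (fun n => ae_of_all _ fun p => ?_) ?_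
      (ae_of_all _ fun p => ?_)
    · simp only [G, Real.enorm_of_nonneg (jetNorm_nonneg _ _)]
      gcongr
      exact hB _
    · rw [setLIntegral_const]; finiteness
    · refine (ENNReal.continuous_rpow_const.tendsto _).comp ?_
      refine (continuous_enorm.tendsto _).comp ?_
      refine (hφ.continuous_jetNorm.tendsto _).comp ?_
      exact tendsto_const_nhds.prodMk_nhds
        (((continuous_fold_param T p.2).tendsto 0).comp hεt)
  have hG0 : eLpNorm (G 0) 2 (volume.restrict S)
      ≤ (3 : ENNReal) ^ (1 / 2 : ℝ) * eLpNorm (jetNorm φ) 2 (volume.restrict (cyl Ω T)) := by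
    rw [hpow, hpow, ← ENNReal.mul_rpow_of_nonneg _ _ (by norm_num)]
    refine ENNReal.rpow_le_rpow ?_ (by norm_num)
    exact lintegral_fold_prod_le (F := fun p => ‖jetNorm φ p‖ₑ ^ (2 : ℝ))
      (hφ.continuous_jetNorm.enorm.measurable.pow_const _)
  have hcyl : MeasurableSet (cyl Ω T) := hΩ.prod measurableSet_Ioo
  calc eLpNorm φ 4 (volume.restrict (cyl Ω T))
      = eLpNorm (Ψ 0) 4 (volume.restrict (cyl Ω T)) := by
        refine eLpNorm_congr_ae ?_
        filter_upwards [ae_restrict_mem hcyl] with p hp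
        simp [Ψ, hχ1 _ hp.2, fold_zero_of_mem (Ioo_subset_Icc_self hp.2)]
    _ ≤ eLpNorm (Ψ 0) 4 volume := eLpNorm_mono_measure _ Measure.restrict_le_self
    -- Fatou's lemma: `Ψ 0` is only Lipschitz in time, so the Sobolev inequality is used on the
    -- smoothed functions alone.
    _ ≤ liminf (fun n => eLpNorm (Ψ (ε n)) 4 volume) atTop := by
        refine Lp.eLpNorm_lim_le_liminf_eLpNorm (fun n => (hΨc _).aestronglyMeasurable) _
          (ae_of_all _ fun p => ?_)
        refine tendsto_const_nhds.mul ((hφ.1.continuous.tendsto _).comp ?_)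
        exact tendsto_const_nhds.prodMk_nhds
          (((continuous_fold_param T p.2).tendsto 0).comp hεt)
    _ ≤ liminf (fun n => K * (ENNReal.ofReal M * eLpNorm (G (ε n)) 2 (volume.restrict S)))
        atTop := liminf_le_liminf (Eventually.of_forall hsob)
    _ = K * (ENNReal.ofReal M * eLpNorm (G 0) 2 (volume.restrict S)) :=
        (ENNReal.Tendsto.const_mul (ENNReal.Tendsto.const_mul hlim (by simp))
          (by simp)).liminf_eq
    _ ≤ _ := by
        rw [mul_assoc, mul_assoc]
        gcongr

/-- The Sobolev inequality involves the operator norm of the derivative, whereas `VanishesOnLateral`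
controls partial derivatives. Expanding a vector in the standard basis links the two. -/
lemma jetNorm_le (φ : SpaceTime d → ℝ) (p : SpaceTime d) :
    jetNorm φ p ≤ ‖φ p‖ + (‖dt φ p‖ + ∑ i, ‖dx i φ p‖) := by
  refine add_le_add le_rfl ?_
  refine ContinuousLinearMap.opNorm_le_bound _ (by positivity) fun v => ?_
  have hv : v = v.2 • ((0 : Space d), (1 : ℝ))
      + ∑ i, v.1 i • ((EuclideanSpace.single i (1 : ℝ) : Space d), (0 : ℝ)) := by
    refine Prod.ext ?_ ?_
    · ext j
      simp [Prod.fst_sum, Pi.single_apply]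
    · simp [Prod.snd_sum]
  conv_lhs => rw [hv]
  rw [map_add, map_sum, map_smul]
  simp only [map_smul]
  refine (norm_add_le _ _).trans ?_
  rw [add_mul, Finset.sum_mul]
  refine add_le_add ?_ ((norm_sum_le _ _).trans (Finset.sum_le_sum fun i _ => ?_))
  · rw [norm_smul, mul_comm]
    exact mul_le_mul_of_nonneg_left (norm_snd_le v) (norm_nonneg _)
  · rw [norm_smul, mul_comm]
    exact mul_le_mul_of_nonneg_left ((PiLp.norm_apply_le v.1 i).trans (norm_fst_le v))
      (norm_nonneg _)

/-- Functions in `H¹(Q_T)` vanishing on `Σ_T` belong to `L⁴(Q_T)`. -/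
theorem VanishesOnLateral.memLp_four (hd : d = 2 ∨ d = 3) {Ω : Set (Space d)}
    (hΩ : MeasurableSet Ω) (hΩb : Bornology.IsBounded Ω) {T : ℝ} (hT : 0 < T)
    {y : SpaceTime d → ℝ} (hy : MemLp y 2 (volume.restrict (cyl Ω T)))
    (h : VanishesOnLateral Ω T y) : MemLp y 4 (volume.restrict (cyl Ω T)) := by
  obtain ⟨v, q, hv, hq, φ, hφ, hφy, hφv, hφq⟩ := h
  obtain ⟨C, hC, hsob⟩ := exists_eLpNorm_four_le hd hΩ hΩb hT
  set μ := volume.restrict (cyl Ω T) with hμ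
  have hdtc : ∀ n, Continuous (dt (φ n)) := fun n =>
    ((hφ n).1.continuous_fderiv (by simp)).clm_apply continuous_const
  have hdxc : ∀ n i, Continuous (dx i (φ n)) := fun n i =>
    ((hφ n).1.continuous_fderiv (by simp)).clm_apply continuous_const
  have hbound : ∀ (ψ : ℕ → SpaceTime d → ℝ) (w : SpaceTime d → ℝ), (∀ n, Continuous (ψ n)) →
      MemLp w 2 μ → Tendsto (fun n => eLpNorm (ψ n - w) 2 μ) atTop (𝓝 0) →
      ∀ᶠ n in atTop, eLpNorm (ψ n) 2 μ ≤ 1 + eLpNorm w 2 μ := by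
    intro ψ w hψ hw ht
    filter_upwards [ht.eventually (gt_mem_nhds zero_lt_one)] with n hn
    calc eLpNorm (ψ n) 2 μ = eLpNorm ((ψ n - w) + w) 2 μ := by rw [sub_add_cancel]
      _ ≤ eLpNorm (ψ n - w) 2 μ + eLpNorm w 2 μ :=
        eLpNorm_add_le ((hψ n).aestronglyMeasurable.sub hw.1) hw.1 (by norm_num)
      _ ≤ _ := by gcongr
  set R : ENNReal := (1 + eLpNorm y 2 μ)
    + ((1 + eLpNorm v 2 μ) + ∑ i, (1 + eLpNorm (q i) 2 μ)) with hR
  have hRfin : R ≠ ⊤ := by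
    have h1 := hy.eLpNorm_ne_top
    have h2 := hv.eLpNorm_ne_top
    have h3 : ∑ i, (1 + eLpNorm (q i) 2 μ) ≠ ⊤ :=
      ENNReal.sum_ne_top.2 fun i _ => ENNReal.add_ne_top.2 ⟨by simp, (hq i).eLpNorm_ne_top⟩
    finiteness
  -- Only boundedness of the approximants in `H¹` is used; Fatou along an a.e. convergent
  -- subsequence then passes the `L⁴` bound to `y`.
  have hev : ∀ᶠ n in atTop, eLpNorm (φ n) 4 μ ≤ C * R := by
    filter_upwards [hbound φ y (fun n => (hφ n).1.continuous) hy hφy, hbound _ v hdtc hv hφv,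
      eventually_all.2 fun i => hbound _ (q i) (fun n => hdxc n i) (hq i) (hφq i)] with n h1 h2 h3
    refine (hsob _ (hφ n)).trans (mul_le_mul_right ?_ _)
    calc eLpNorm (jetNorm (φ n)) 2 μ
        ≤ eLpNorm ((fun p => ‖φ n p‖) + ((fun p => ‖dt (φ n) p‖)
            + ∑ i, fun p => ‖dx i (φ n) p‖)) 2 μ := by
          refine eLpNorm_mono fun p => ?_
          rw [Real.norm_of_nonneg (jetNorm_nonneg _ _)]
          refine (jetNorm_le (φ n) p).trans ?_
          simp only [Pi.add_apply, Finset.sum_apply]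
          exact Real.le_norm_self _
      _ ≤ eLpNorm (φ n) 2 μ + (eLpNorm (dt (φ n)) 2 μ + ∑ i, eLpNorm (dx i (φ n)) 2 μ) := by
          have m1 := (hφ n).1.continuous.norm.aestronglyMeasurable (μ := μ)
          have m2 := (hdtc n).norm.aestronglyMeasurable (μ := μ)
          have m3 := fun i => (hdxc n i).norm.aestronglyMeasurable (μ := μ)
          have m4 : AEStronglyMeasurable (∑ i, fun p => ‖dx i (φ n) p‖) μ :=
            Finset.aestronglyMeasurable_sum _ fun i _ => m3 i
          refine (eLpNorm_add_le m1 (m2.add m4) (by norm_num)).trans ?_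
          rw [eLpNorm_norm]
          gcongr
          refine (eLpNorm_add_le m2 m4 (by norm_num)).trans ?_
          rw [eLpNorm_norm]
          gcongr
          refine (eLpNorm_sum_le (fun i _ => m3 i) (by norm_num)).trans_eq ?_
          simp only [eLpNorm_norm]
      _ ≤ R := add_le_add h1 (add_le_add h2 (Finset.sum_le_sum fun i _ => h3 i))
  obtain ⟨ns, hns, hae⟩ := (tendstoInMeasure_of_tendsto_eLpNorm (p := 2) (by simp)
    (fun n => (hφ n).1.continuous.aestronglyMeasurable) hy.1 hφy).exists_seq_tendsto_ae
  refine ⟨hy.1, lt_of_le_of_lt ?_ (ENNReal.mul_lt_top hC.lt_top hRfin.lt_top)⟩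
  refine (Lp.eLpNorm_lim_le_liminf_eLpNorm
    (fun n => (hφ (ns n)).1.continuous.aestronglyMeasurable) y hae).trans ?_
  exact (liminf_le_liminf (v := fun _ => C * R) (hns.tendsto_atTop.eventually hev)).trans_eq
    (liminf_const _)

end Sobolev

end WaveControl

namespace WaveControl

/-! ### The wave operator is linear -/

section WaveOp

variable {d : ℕ} {Ω : Set (Space d)} {T : ℝ}

lemma IsTest.continuous_boxTest {U : Set (SpaceTime d)} {η : SpaceTime d → ℝ} (hη : IsTest U η) :
    Continuous (boxTest η) ∧ HasCompactSupport (boxTest η) := by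
  have key : ∀ v w : SpaceTime d,
      Continuous (fun p => fderiv ℝ (fun p' => fderiv ℝ η p' v) p w) ∧
      HasCompactSupport (fun p => fderiv ℝ (fun p' => fderiv ℝ η p' v) p w) := by
    intro v w
    have h1 : ContDiff ℝ 1 (fun p' => fderiv ℝ η p' v) :=
      (hη.1.fderiv_right (m := 1) (by norm_cast)).clm_apply contDiff_const
    refine ⟨(h1.continuous_fderiv (by simp)).clm_apply continuous_const, ?_⟩
    exact (hη.2.1.fderiv_apply ℝ v).fderiv_apply ℝ w
  constructor
  · exact (key _ _).1.sub (continuous_finsetSum _ fun i _ => (key _ _).1)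
  · have hs : ∀ s : Finset (Fin d),
        HasCompactSupport (fun p => ∑ i ∈ s, dx i (dx i η) p) := by
      intro s
      classical
      induction s using Finset.induction_on with
      | empty => exact HasCompactSupport.zero
      | insert a s ha ih =>
        simp only [Finset.sum_insert ha]
        exact HasCompactSupport.add (key _ _).2 ih
    exact HasCompactSupport.sub (key _ _).2 (hs _)

lemma integrable_mul_of_compactSupport {μ : Measure (SpaceTime d)} [IsFiniteMeasureOnCompacts μ]
    {y b : SpaceTime d → ℝ} (hy : MemLp y 2 μ) (hb : Continuous b) (hbc : HasCompactSupport b) :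
    Integrable (fun p => y p * b p) μ :=
  hy.integrable_mul (hb.memLp_of_hasCompactSupport (p := 2) hbc)

lemma IsWaveOp.add_smul {y Y w W : SpaceTime d → ℝ} (hy : MemLp y 2 (volume.restrict (cyl Ω T)))
    (hY : MemLp Y 2 (volume.restrict (cyl Ω T))) (hw : IsWaveOp Ω T y w) (hW : IsWaveOp Ω T Y W)
    (c : ℝ) : IsWaveOp Ω T (y + c • Y) (w + c • W) := by
  refine ⟨hw.1.add (hW.1.const_smul c), fun η hη => ?_⟩
  obtain ⟨hb, hbc⟩ := hη.continuous_boxTest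
  have e : ∀ {a A b : SpaceTime d → ℝ}, MemLp a 2 (volume.restrict (cyl Ω T)) →
      MemLp A 2 (volume.restrict (cyl Ω T)) → Continuous b → HasCompactSupport b →
      ∫ p in cyl Ω T, (a + c • A) p * b p
        = (∫ p in cyl Ω T, a p * b p) + c * ∫ p in cyl Ω T, A p * b p := by
    intro a A b ha hA hb hbc
    rw [← integral_const_mul, ← integral_add (integrable_mul_of_compactSupport ha hb hbc)
      ((integrable_mul_of_compactSupport hA hb hbc).const_mul c)]
    refine integral_congr_ae (ae_of_all _ fun p => ?_)
    simp only [Pi.add_apply, Pi.smul_apply, smul_eq_mul]; ring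
  rw [e hy hY hb hbc, e hw.1 hW.1 hη.1.continuous hη.2.1, hw.2 η hη, hW.2 η hη]

/-- Fundamental lemma of the calculus of variations. Since `waveOp` is an arbitrary choice of
representative, its linearity can only hold almost everywhere and rests on this uniqueness. -/
lemma IsWaveOp.ae_eq (hΩ : IsOpen Ω) {y w w' : SpaceTime d → ℝ} (hw : IsWaveOp Ω T y w)
    (hw' : IsWaveOp Ω T y w') : w =ᵐ[volume.restrict (cyl Ω T)] w' := by
  have hU : IsOpen (cyl Ω T) := hΩ.prod isOpen_Ioo
  have hloc : LocallyIntegrable (w - w') (volume.restrict (cyl Ω T)) :=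
    (hw.1.sub hw'.1).locallyIntegrable (by norm_num)
  have := hU.ae_eq_zero_of_integral_contDiff_smul_eq_zero (f := w - w')
    (μ := volume.restrict (cyl Ω T)) (hloc.locallyIntegrableOn _) fun η h1 h2 h3 => by
      have hη : IsTest (cyl Ω T) η := ⟨h1, h2, h3⟩
      have i1 := integrable_mul_of_compactSupport hw.1 hη.1.continuous hη.2.1
      have i2 := integrable_mul_of_compactSupport hw'.1 hη.1.continuous hη.2.1
      have := integral_sub i1 i2
      rw [← hw.2 η hη, ← hw'.2 η hη, sub_self] at this
      rw [← this]
      refine integral_congr_ae (ae_of_all _ fun p => ?_)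
      simp only [Pi.sub_apply, smul_eq_mul]; ring
  filter_upwards [this, ae_restrict_mem hU.measurableSet] with p hp hpU
  exact sub_eq_zero.1 (hp hpU)

lemma isWaveOp_waveOp {y : SpaceTime d → ℝ} (h : ∃ w, IsWaveOp Ω T y w) :
    IsWaveOp Ω T y (waveOp Ω T y) := by
  rw [waveOp, dif_pos h]; exact h.choose_spec

lemma waveOp_add_smul (hΩ : IsOpen Ω) {y Y : SpaceTime d → ℝ}
    (hy : MemLp y 2 (volume.restrict (cyl Ω T))) (hY : MemLp Y 2 (volume.restrict (cyl Ω T)))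
    (hw : ∃ w, IsWaveOp Ω T y w) (hW : ∃ w, IsWaveOp Ω T Y w) (c : ℝ) :
    waveOp Ω T (y + c • Y) =ᵐ[volume.restrict (cyl Ω T)] waveOp Ω T y + c • waveOp Ω T Y :=
  have h := (isWaveOp_waveOp hw).add_smul hy hY (isWaveOp_waveOp hW) c
  (isWaveOp_waveOp ⟨_, h⟩).ae_eq hΩ h

lemma memLp_localize {ω : Set (Space d)} (hω : MeasurableSet ω)
    (hsub : ω ⊆ Ω) {f : SpaceTime d → ℝ} (hf : MemLp f 2 (volume.restrict (cyl ω T))) :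
    MemLp (localize ω f) 2 (volume.restrict (cyl Ω T)) := by
  rw [localize, memLp_indicator_iff_restrict (hω.prod MeasurableSet.univ),
    Measure.restrict_restrict (hω.prod MeasurableSet.univ)]
  have : (ω ×ˢ univ) ∩ cyl Ω T = cyl ω T := by
    rw [cyl, prod_inter_prod, univ_inter, inter_eq_self_of_subset_left hsub, cyl]
  rwa [this]

lemma localize_add_smul (ω : Set (Space d)) (f F : SpaceTime d → ℝ) (c : ℝ) :
    localize ω (f + c • F) = localize ω f + c • localize ω F := by
  ext p
  by_cases hp : p ∈ ω ×ˢ (univ : Set ℝ) <;> simp only [localize, Pi.add_apply, Pi.smul_apply,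
    indicator_of_mem, indicator_of_notMem, hp, not_false_eq_true, smul_zero, add_zero]

end WaveOp

/-! ### Growth of the nonlinearity -/

/-- The logarithm is replaced by the crude `log (2 + |r|) ≤ 1 + |r|`; quadratic growth is what `L⁴`
functions can absorb in `L²`. -/
lemma abs_le_mul_sq_of_log_growth {g : ℝ → ℝ} {C : ℝ} (hC : 0 < C)
    (hg : ∀ r : ℝ, |g r| ≤ C * (1 + |r|) * Real.log (2 + |r|)) (r : ℝ) :
    |g r| ≤ C * (1 + |r|) ^ 2 := by
  have := Real.log_le_sub_one_of_pos (x := 2 + |r|) (by positivity)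
  calc |g r| ≤ C * (1 + |r|) * Real.log (2 + |r|) := hg r
    _ ≤ C * (1 + |r|) * (1 + |r|) := by gcongr; linarith
    _ = _ := by ring

/-- Compare `g'(r)` with `g'(0)` and use `|r|^s ≤ 1 + |r|` for `0 ≤ s ≤ 1`. -/
lemma HolderDeriv.exists_abs_deriv_le {g : ℝ → ℝ} {s : ℝ} (hs : s ∈ Icc (0 : ℝ) 1)
    (h : HolderDeriv g s) : ∃ A : ℝ, 0 ≤ A ∧ ∀ r, |deriv g r| ≤ A * (1 + |r|) := by
  obtain ⟨K, hK⟩ := h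
  have hK' : ∀ r, r ≠ 0 → |deriv g r - deriv g 0| ≤ |K| * (1 + |r|) := by
    intro r hr
    have h1 : |deriv g r - deriv g 0| / |r - 0| ^ s ≤ K := hK ⟨r, 0, hr, rfl⟩
    have hp : 0 < |r - 0| ^ s := Real.rpow_pos_of_pos (by simpa using hr) s
    rw [div_le_iff₀ hp] at h1
    have h2 : |r - 0| ^ s ≤ 1 + |r| := by
      rw [sub_zero]
      calc |r| ^ s ≤ (1 + |r|) ^ s := Real.rpow_le_rpow (abs_nonneg _) (by linarith) hs.1
        _ ≤ (1 + |r|) ^ (1 : ℝ) :=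
          Real.rpow_le_rpow_of_exponent_le (by linarith [abs_nonneg r]) hs.2
        _ = _ := Real.rpow_one _
    exact h1.trans (mul_le_mul (le_abs_self K) h2 hp.le (abs_nonneg K))
  refine ⟨|K| + |deriv g 0|, by positivity, fun r => ?_⟩
  rcases eq_or_ne r 0 with rfl | hr
  · simp
  · have h3 := abs_sub_abs_le_abs_sub (deriv g r) (deriv g 0)
    have h4 := hK' r hr
    nlinarith [mul_nonneg (abs_nonneg (deriv g 0)) (abs_nonneg r)]

/-! ### Differentiation of the functional -/

section Derivative

variable {α : Type*} {m : MeasurableSpace α} {μ : Measure α} [IsFiniteMeasure μ]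

lemma memLp_two_one_add_sq {y : α → ℝ} (hy : MemLp y 4 μ) :
    MemLp (fun p => (1 + |y p|) ^ 2) 2 μ := by
  have h0 : MemLp (fun _ : α => (1 : ℝ)) 4 μ := memLp_const 1
  have h1 : MemLp (fun p => 1 + |y p|) 4 μ := h0.add hy.norm
  have : ENNReal.HolderTriple 4 4 2 := ⟨by
    rw [← two_mul, show (4 : ENNReal) = 2 * 2 by norm_num,
      ENNReal.mul_inv (by simp) (by simp), ← mul_assoc,
      ENNReal.mul_inv_cancel (by simp) (by simp), one_mul]⟩
  have h2 := h1.mul (r := 2) h1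
  refine h2.congr_norm ?_ (ae_of_all _ fun p => ?_)
  · exact ((aestronglyMeasurable_const.add hy.norm.1).pow 2)
  · simp [sq]

/-- Differentiation of `½ ∫ (R + λ L + g(y + λ Y) - g(y))²` at `λ = 0`. -/
theorem hasDerivAt_half_integral_sq {g : ℝ → ℝ} (hg : ContDiff ℝ 1 g) {C A : ℝ} (hC : 0 ≤ C)
    (hgC : ∀ r, |g r| ≤ C * (1 + |r|) ^ 2) (hA : 0 ≤ A)
    (hgA : ∀ r, |deriv g r| ≤ A * (1 + |r|)) {R L y Y : α → ℝ}
    (hR : MemLp R 2 μ) (hL : MemLp L 2 μ) (hy : MemLp y 4 μ) (hY : MemLp Y 4 μ) :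
    HasDerivAt (fun t : ℝ => (1 / 2) * ∫ p, (R p + t * L p + (g (y p + t * Y p) - g (y p))) ^ 2 ∂μ)
      (∫ p, R p * (L p + deriv g (y p) * Y p) ∂μ) 0 := by
  have hgd : ∀ r, HasDerivAt g (deriv g r) r := fun r =>
    (hg.differentiable (by simp) r).hasDerivAt
  have hg' : Continuous (deriv g) := hg.continuous_deriv (by simp)
  have hz : MemLp (fun p => |y p| + |Y p|) 4 μ := hy.norm.add hY.norm
  -- One majorant for all `|t| ≤ 1`: `C Z` bounds both values of `g`, and `A Z` bounds `g'(y + t Y)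
  -- Y`.
  set Z : α → ℝ := fun p => (1 + (|y p| + |Y p|)) ^ 2 with hZdef
  have hZ : MemLp Z 2 μ := by
    refine (memLp_two_one_add_sq hz).congr_norm ?_ (ae_of_all _ fun p => ?_)
    · exact (aestronglyMeasurable_const.add hz.1).pow 2
    · rw [abs_of_nonneg (by positivity : 0 ≤ |y p| + |Y p|)]
  have hgm : ∀ t : ℝ, AEStronglyMeasurable (fun p => g (y p + t * Y p)) μ := fun t =>
    hg.continuous.comp_aestronglyMeasurable (hy.1.add (hY.1.const_mul t))
  have hgm0 : AEStronglyMeasurable (fun p => g (y p)) μ :=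
    hg.continuous.comp_aestronglyMeasurable hy.1
  have hb1 : MemLp (fun p => |R p| + |L p| + 2 * C * Z p) 2 μ :=
    (hR.norm.add hL.norm).add (hZ.const_mul (2 * C))
  have hb2 : MemLp (fun p => |L p| + A * Z p) 2 μ := hL.norm.add (hZ.const_mul A)
  have hle : ∀ t ∈ Metric.ball (0 : ℝ) 1, ∀ p, |y p + t * Y p| ≤ |y p| + |Y p| := by
    intro t ht p
    have ht' : |t| ≤ 1 := by
      rw [mem_ball_zero_iff, Real.norm_eq_abs] at ht; exact ht.le
    refine (abs_add_le _ _).trans ?_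
    rw [abs_mul]
    gcongr
    exact mul_le_of_le_one_left (abs_nonneg _) ht'
  have hres : HasDerivAt (fun t : ℝ => ∫ p, (R p + t * L p + (g (y p + t * Y p) - g (y p))) ^ 2 ∂μ)
      (∫ p, 2 * (R p + 0 * L p + (g (y p + 0 * Y p) - g (y p)))
        * (L p + deriv g (y p + 0 * Y p) * Y p) ∂μ) 0 := by
    refine (hasDerivAt_integral_of_dominated_loc_of_deriv_le (μ := μ)
      (F := fun t p => (R p + t * L p + (g (y p + t * Y p) - g (y p))) ^ 2)
      (F' := fun t p => 2 * (R p + t * L p + (g (y p + t * Y p) - g (y p)))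
        * (L p + deriv g (y p + t * Y p) * Y p))
      (bound := fun p => 2 * ((|R p| + |L p| + 2 * C * Z p) * (|L p| + A * Z p)))
      (Metric.ball_mem_nhds 0 one_pos) (Eventually.of_forall fun t => ?_) ?_ ?_
      (ae_of_all _ fun p t ht => ?_) ?_ (ae_of_all _ fun p t _ => ?_)).2
    · exact ((hR.1.add (hL.1.const_mul t)).add ((hgm t).sub hgm0)).pow 2
    · simpa using hR.integrable_sq
    · exact (((hR.1.add (hL.1.const_mul 0)).add ((hgm 0).sub hgm0)).const_mul 2).mul
        (hL.1.add ((hg'.comp_aestronglyMeasurable (hy.1.add (hY.1.const_mul 0))).mul hY.1))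
    · have ht' : |t| ≤ 1 := by
        rw [mem_ball_zero_iff, Real.norm_eq_abs] at ht; exact ht.le
      have k0 := hle t ht p
      have k1 : |g (y p + t * Y p)| ≤ C * Z p := by
        refine (hgC _).trans ?_
        simp only [hZdef]; gcongr
      have k2 : |g (y p)| ≤ C * Z p := by
        refine (hgC _).trans ?_
        simp only [hZdef]; gcongr
        linarith [abs_nonneg (Y p)]
      have k3 : |t * L p| ≤ |L p| := by
        rw [abs_mul]; exact mul_le_of_le_one_left (abs_nonneg _) ht'
      have k4 : |deriv g (y p + t * Y p) * Y p| ≤ A * Z p := by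
        rw [abs_mul]
        calc |deriv g (y p + t * Y p)| * |Y p|
            ≤ (A * (1 + (|y p| + |Y p|))) * (1 + (|y p| + |Y p|)) := by
              refine mul_le_mul ((hgA _).trans (by gcongr)) ?_ (abs_nonneg _) (by positivity)
              linarith [abs_nonneg (y p)]
          _ = A * Z p := by simp only [hZdef]; ring
      rw [Real.norm_eq_abs, abs_mul, abs_mul, abs_two, mul_assoc]
      refine mul_le_mul_of_nonneg_left ?_ zero_le_two
      refine mul_le_mul ?_ ((abs_add_le _ _).trans (by linarith)) (abs_nonneg _) ?_
      · refine (abs_add_le _ _).trans ?_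
        have := abs_add_le (R p) (t * L p)
        have := abs_sub (g (y p + t * Y p)) (g (y p))
        linarith
      · have : 0 ≤ Z p := sq_nonneg _
        positivity
    · exact (hb1.integrable_mul hb2).const_mul 2
    · have e1 : HasDerivAt (fun t : ℝ => y p + t * Y p) (Y p) t := by
        simpa using ((hasDerivAt_id t).mul_const (Y p)).const_add (y p)
      have e2 : HasDerivAt (fun t : ℝ => R p + t * L p) (L p) t := by
        simpa using ((hasDerivAt_id t).mul_const (L p)).const_add (R p)
      have e3 := (e2.add (((hgd _).comp t e1).sub_const (g (y p)))).pow 2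
      refine (e3.congr_deriv ?_)
      simp only [Pi.add_apply, Function.comp_apply]
      norm_num
  refine (hres.const_mul (1 / 2)).congr_deriv ?_
  rw [← integral_const_mul]
  refine integral_congr_ae (ae_of_all _ fun p => ?_)
  simp only [zero_mul, add_zero, sub_self]
  ring

end Derivative

end WaveControl

namespace WaveControl

/-! ### Differentiating the least-squares functional. -/

section Energy

variable {d : ℕ} {Ω ω : Set (Space d)} {T : ℝ}

lemma memLp_residual (hΩb : Bornology.IsBounded Ω) (hω : IsOpen ω)
    (hsub : ω ⊆ Ω) {g : ℝ → ℝ} (hg : Continuous g) {C : ℝ}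
    (hgC : ∀ r, |g r| ≤ C * (1 + |r|) ^ 2) {P : (SpaceTime d → ℝ) × (SpaceTime d → ℝ)}
    (hP : P ∈ spaceH Ω ω T) (hP4 : MemLp P.1 4 (volume.restrict (cyl Ω T))) :
    MemLp (residual Ω ω T g P) 2 (volume.restrict (cyl Ω T)) := by
  have : IsFiniteMeasure (volume.restrict (cyl Ω T)) :=
    isFiniteMeasure_restrict.2 (hΩb.prod (Metric.isBounded_Ioo _ _)).measure_lt_top.ne
  have hgP : MemLp (fun p => g (P.1 p)) 2 (volume.restrict (cyl Ω T)) :=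
    (memLp_two_one_add_sq hP4).of_le_mul (c := C) (hg.comp_aestronglyMeasurable hP4.1)
      (ae_of_all _ fun p => by
        rw [Real.norm_of_nonneg (sq_nonneg (1 + |P.1 p|))]; exact hgC _)
  exact ((isWaveOp_waveOp hP.2.2.1).1.add hgP).sub
    (memLp_localize hω.measurableSet hsub hP.2.1)

/-- The derivative of the least-squares functional along a direction `D`. -/
theorem hasLineDerivAt_energy (hΩ : IsOpen Ω) (hΩb : Bornology.IsBounded Ω) (hω : IsOpen ω)
    (hsub : ω ⊆ Ω) {g : ℝ → ℝ} (hg : ContDiff ℝ 1 g) {C A : ℝ} (hC : 0 ≤ C)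
    (hgC : ∀ r, |g r| ≤ C * (1 + |r|) ^ 2) (hA : 0 ≤ A)
    (hgA : ∀ r, |deriv g r| ≤ A * (1 + |r|)) {P D : (SpaceTime d → ℝ) × (SpaceTime d → ℝ)}
    (hP : P ∈ spaceH Ω ω T) (hP4 : MemLp P.1 4 (volume.restrict (cyl Ω T)))
    (hD : D ∈ spaceH Ω ω T) (hD4 : MemLp D.1 4 (volume.restrict (cyl Ω T))) :
    HasLineDerivAt ℝ (energy Ω ω T g)
      (∫ p in cyl Ω T, residual Ω ω T g P p *
        ((waveOp Ω T D.1 p - localize ω D.2 p) + deriv g (P.1 p) * D.1 p)) P D := by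
  have : IsFiniteMeasure (volume.restrict (cyl Ω T)) :=
    isFiniteMeasure_restrict.2 (hΩb.prod (Metric.isBounded_Ioo _ _)).measure_lt_top.ne
  have hR := memLp_residual hΩb hω hsub hg.continuous hgC hP hP4
  have hL := (isWaveOp_waveOp hD.2.2.1).1.sub (memLp_localize hω.measurableSet hsub hD.2.1)
  have key := hasDerivAt_half_integral_sq hg hC hgC hA hgA hR hL hP4 hD4
  refine key.congr_of_eventuallyEq (Eventually.of_forall fun t => ?_)
  simp only [energy]
  congr 1
  refine integral_congr_ae ?_
  filter_upwards [waveOp_add_smul hΩ hP.1 hD.1 hP.2.2.1 hD.2.2.1 t] with p hp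
  simp only [residual, Prod.fst_add, Prod.snd_add, Prod.smul_fst, Prod.smul_snd,
    localize_add_smul, hp, Pi.add_apply, Pi.smul_apply, Pi.sub_apply, smul_eq_mul]
  ring

end Energy

end WaveControl

theorem mainTheorem4 {d : ℕ} (hd : d = 2 ∨ d = 3)
    (Ω ω : Set (WaveControl.Space d))
    (hΩ_open : IsOpen Ω) (hΩ_conn : IsConnected Ω) (hΩ_bdd : Bornology.IsBounded Ω)
    (hω_open : IsOpen ω) (hω_ne : ω.Nonempty) (hω : closure ω ⊆ Ω)
    (T : ℝ) (hT : 0 < T)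
    (g : ℝ → ℝ) (hg : ContDiff ℝ 1 g)
    (hg_growth : ∃ C : ℝ, 0 < C ∧ ∀ r : ℝ, |g r| ≤ C * (1 + |r|) * Real.log (2 + |r|))
    (s : ℝ) (hs : s ∈ Set.Icc (0 : ℝ) 1) (hg_holder : WaveControl.HolderDeriv g s)
    (u₀ u₁ z₀ z₁ : WaveControl.Space d → ℝ)
    (hu : WaveControl.MemV Ω u₀ u₁) (hz : WaveControl.MemV Ω z₀ z₁)
    (y f : WaveControl.SpaceTime d → ℝ)
    (hyf : (y, f) ∈ WaveControl.admissible Ω ω T u₀ u₁ z₀ z₁) :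
    MeasureTheory.MemLp (WaveControl.residual Ω ω T g (y, f)) 2
        (MeasureTheory.volume.restrict (WaveControl.cyl Ω T)) ∧
    (∀ Y F : WaveControl.SpaceTime d → ℝ, (Y, F) ∈ WaveControl.admissibleZero Ω ω T →
      LineDifferentiableAt ℝ (WaveControl.energy Ω ω T g) (y, f) (Y, F)) ∧
    (∀ Y₁ F₁ : WaveControl.SpaceTime d → ℝ, (Y₁, F₁) ∈ WaveControl.admissibleZero Ω ω T →
      WaveControl.SolvesLinearized Ω ω T g (y, f) (Y₁, F₁) →
      HasLineDerivAt ℝ (WaveControl.energy Ω ω T g)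
        (2 * WaveControl.energy Ω ω T g (y, f)) (y, f) (Y₁, F₁)) := by
  obtain ⟨C, hC, hgC⟩ := hg_growth
  obtain ⟨A, hA, hgA⟩ := hg_holder.exists_abs_deriv_le hs
  have hgC' := WaveControl.abs_le_mul_sq_of_log_growth hC hgC
  have hsub : ω ⊆ Ω := subset_closure.trans hω
  have h4 : ∀ P ∈ WaveControl.spaceH Ω ω T,
      MemLp P.1 4 (volume.restrict (WaveControl.cyl Ω T)) := fun P hP =>
    hP.2.2.2.2.memLp_four hd hΩ_open.measurableSet hΩ_bdd hT hP.1
  have hderiv := fun D (hD : D ∈ WaveControl.spaceH Ω ω T) =>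
    WaveControl.hasLineDerivAt_energy hΩ_open hΩ_bdd hω_open hsub hg hC.le hgC' hA hgA
      hyf.1 (h4 _ hyf.1) hD (h4 _ hD)
  refine ⟨WaveControl.memLp_residual hΩ_bdd hω_open hsub hg.continuous hgC' hyf.1
    (h4 _ hyf.1), fun Y F hD => (hderiv _ hD.1).lineDifferentiableAt, fun Y F hD hlin => ?_⟩
  -- It remains to see that `2E` is the general derivative: by the linearized equation the second
  -- factor in the integrand is the residual itself.
  convert hderiv _ hD.1 using 1
  rw [WaveControl.energy, ← mul_assoc, mul_one_div_cancel two_ne_zero, one_mul]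
  refine integral_congr_ae ?_
  filter_upwards [hlin] with p hp
  rw [show WaveControl.waveOp Ω T Y p - WaveControl.localize ω F p + deriv g (y p) * Y p
    = WaveControl.residual Ω ω T g (y, f) p by linarith, sq]
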